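/- There is an integer $r_0$ such that the following two statements hold for every integer $r\ge r_0$. All hypergraphs and graphs are finite, and $\log$ is the logarithm to base $2$. (i) (Multi-hypergraph form.) Let $\mathcal G$ be an $r$-uniform multi-hypergraph (every edge is a set of exactly $r$ vertices, and edges may be repeated) on $N\ge 2$ vertices. Let $d(\mathcal G)$ and $\Delta(\mathcal G)$ be the average and the maximum, over the vertices $v$ of $\mathcal G$, of the number of edges (counted with multiplicity) that contain $v$. If $$\Delta(\mathcal G)\le d(\mathcal G)^{1+\frac1{2r}}\qquad\text{and}\qquad d(\mathcal G)\ge r^{3r}(\log N)^2,$$ then $\mathcal G$ contains an $r$-regular sub(multi)hypergraph, that is, a non-empty set $W$ of vertices and a collection of edges of $\mathcal G$ (each edge used at most as often as it occurs in $\mathcal G$), all contained in $W$, such that every vertex of $W$ lies in exactly $r$ edges of the collection, counted with multiplicity. (ii) (Bipartite graph form.) Let $n\ge 2$ be an integer, let $d,\Delta$ be real numbers, and let $G$ be a bipartite simple graph with parts $A$ and $B$ which has at least one and at most $n$ vertices, such that $d_G(v)=r$ for every $v\in B$, $d_G(u)\le\Delta$ for every $u\in A$, and $e(G)=d|A|$,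 where $d\ge r^{3r}(\log n)^2$ and $\Delta\le d^{1+\frac1{2r}}$. Then $G$ contains an $r$-regular subgraph (with a non-empty vertex set). -/

import Mathlib

/-- A multi-hypergraph with vertex set `V` and edges labelled by `E`: every label is sent to the
set of vertices of the edge that it names, so parallel edges are distinct labels with the same
vertex set. -/
structure MultiHypergraph (V E : Type*) where
  /-- the set of vertices of an edge -/
  edgeVerts : E → Finset V

namespace MultiHypergraph

variable {V E : Type*}

/-- Every edge has exactly `r` vertices. -/
def IsUniform (H : MultiHypergraph V E) (r : ℕ) : Prop :=
  ∀ e, (H.edgeVerts e).card = r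

/-- The number of edges, counted with multiplicity, that contain the vertex `v`. -/
def degree [DecidableEq V] [Fintype E] (H : MultiHypergraph V E) (v : V) : ℕ :=
  (Finset.univ.filter fun e => v ∈ H.edgeVerts e).card

/-- The maximum of the degrees of the vertices. -/
def maxDegree [Fintype V] [DecidableEq V] [Fintype E] (H : MultiHypergraph V E) : ℕ :=
  Finset.univ.sup H.degree

/-- The average of the degrees of the vertices. -/
noncomputable def avgDegree [Fintype V] [DecidableEq V] [Fintype E]
    (H : MultiHypergraph V E) : ℝ :=
  (∑ v, (H.degree v : ℝ)) / (Fintype.card V : ℝ)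

/-- A sub(multi)hypergraph: a set of vertices, and a set of edges (whole edges of `H`, each label
used at most once) all of whose vertices are among the chosen ones. -/
structure Sub (H : MultiHypergraph V E) where
  /-- the vertices of the subhypergraph -/
  verts : Finset V
  /-- the edges of the subhypergraph -/
  edges : Finset E
  edgeVerts_subset : ∀ e ∈ edges, H.edgeVerts e ⊆ verts

/-- The number of edges of the subhypergraph that contain the vertex `v`. -/
def Sub.degree [DecidableEq V] {H : MultiHypergraph V E} (S : H.Sub) (v : V) : ℕ :=
  (S.edges.filter fun e => v ∈ H.edgeVerts e).card

/-- Every vertex of the subhypergraph lies in exactly `k` of its edges. -/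
def Sub.IsRegular [DecidableEq V] {H : MultiHypergraph V E} (S : H.Sub) (k : ℕ) : Prop :=
  ∀ v ∈ S.verts, S.degree v = k

end MultiHypergraph

/-! The proof counts matchings. Put D = d^(1/(2r)), so that Δ ≤ dD and D^r = √d. A matching with at
most N/(2r²D) edges blocks at most half of all the edges, so greedy extension gives at least
(dN/(2r))^m / m! matchings with m edges, where m is about N/(2r²D). Each covers rm vertices, and
there are only C(N, rm) sets of that size. By pigeonhole more than κ^m matchings cover the same
vertex set W, where κ = √d/(2(12r)^r).

Since d ≥ r^(3r) log² N, this κ is large enough for the improved sunflower lemma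
(`exists_sunflower`), which needs κ of order only r² log m. It gives r matchings that pairwise meet
exactly in a kernel A. Without A, they become r pairwise disjoint perfect matchings of W minus the
vertices of A, and their union is r-regular (`exists_regular_of_sunflower`).

The sunflower lemma rests on `exists_pairwise_disjoint_of_spread`: under a random colouring with r
colours, each split into k shades, a spread family has with positive probability a member inside
every colour. The shades are exposed one at a time, and each round halves the part of most sets
still to be covered (minimal fragments).

The bipartite form is the hypergraph form for the neighbourhoods of the vertices of B. -/

/-! ### Spread families and minimal fragments. -/

section Spread

open Finset
open scoped Classical

variable {X C ι : Type*}

/-- The colouring `f`, changed to the constant `c` on `T`. -/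
noncomputable def recolour (f : X → C) (T : Finset X) (c : C) : X → C :=
  fun x => if x ∈ T then c else f x

/-- The vertices of colour `c`. -/
noncomputable def colourClass [Fintype X] (f : X → C) (c : C) : Finset X :=
  univ.filter fun x => f x = c

/-- The restriction to members no larger than `g i` keeps the size bound on `g i` valid for the
member that replaces it. -/
theorem exists_minimal_fragment [Fintype ι] (g : ι → Finset X) (W : Finset X) (i : ι) :
    ∃ j, (#(g j) ≤ #(g i) ∧ g j ⊆ g i ∪ W) ∧
      ∀ j', #(g j') ≤ #(g i) → g j' ⊆ g i ∪ W → #(g j \ W) ≤ #(g j' \ W) := by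
  obtain ⟨j, hj, hmin⟩ := exists_min_image
    (univ.filter fun j => #(g j) ≤ #(g i) ∧ g j ⊆ g i ∪ W) (fun j => #(g j \ W))
    ⟨i, by simp⟩
  refine ⟨j, by simpa using hj, fun j' h1 h2 => hmin j' (by simp [h1, h2])⟩

/-- A smallest set `g j \ W` among the `g j ⊆ g i ∪ W` with `#(g j) ≤ #(g i)`. -/
noncomputable def fragment [Fintype ι] (g : ι → Finset X) (W : Finset X) (i : ι) : Finset X :=
  g (exists_minimal_fragment g W i).choose \ W

theorem fragment_subset [Fintype ι] (g : ι → Finset X) (W : Finset X) (i : ι) :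
    fragment g W i ⊆ g i := by
  intro x hx
  have h := (exists_minimal_fragment g W i).choose_spec.1.2
  rw [fragment, mem_sdiff] at hx
  have := h hx.1
  rw [mem_union] at this
  exact this.resolve_right hx.2

theorem notMem_of_mem_fragment [Fintype ι] {g : ι → Finset X} {W : Finset X} {i : ι} {x : X}
    (hx : x ∈ fragment g W i) : x ∉ W := by
  rw [fragment, mem_sdiff] at hx
  exact hx.2

theorem exists_fragment_eq [Fintype ι] (g : ι → Finset X) (W : Finset X) (i : ι) :
    ∃ j, #(g j) ≤ #(g i) ∧ fragment g W i = g j \ W :=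
  ⟨_, (exists_minimal_fragment g W i).choose_spec.1.1, rfl⟩

theorem card_fragment_le [Fintype ι] {g : ι → Finset X} {W : Finset X} {i j : ι}
    (h1 : #(g j) ≤ #(g i)) (h2 : g j ⊆ g i ∪ W) : #(fragment g W i) ≤ #(g j \ W) :=
  (exists_minimal_fragment g W i).choose_spec.2 j h1 h2

theorem mem_colourClass [Fintype X] {f : X → C} {c : C} {x : X} :
    x ∈ colourClass f c ↔ f x = c := by
  simp [colourClass]

theorem colourClass_recolour [Fintype X] (f : X → C) (T : Finset X) (c : C) :
    colourClass (recolour f T c) c = T ∪ colourClass f c := by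
  ext x
  simp only [mem_colourClass, recolour, mem_union]
  by_cases hx : x ∈ T <;> simp [hx]

/-- Fragments left by colour `c` avoid its class, so recolouring inside them in a later round does
not disturb the earlier rounds. -/
theorem colourClass_recolour_of_ne [Fintype X] (f : X → C) {T : Finset X} {c c' : C}
    (hc : c ≠ c') (hT : ∀ x ∈ T, x ∉ colourClass f c) :
    colourClass (recolour f T c') c = colourClass f c := by
  ext x
  have := hT x
  simp only [mem_colourClass, recolour] at this ⊢
  by_cases hx : x ∈ T
  · simp [hx, this hx, hc.symm]
  · simp [hx]

/-- Colourings that agree with a given one off `T`. -/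
theorem card_agree_off_le [Fintype X] [Fintype C] (f' : X → C) (T : Finset X) :
    #(univ.filter fun f : X → C => ∀ x, x ∉ T → f x = f' x) ≤ Fintype.card C ^ #T := by
  have h : Fintype.card (T → C) = Fintype.card C ^ #T := by simp
  rw [← h, ← card_univ]
  refine card_le_card_of_injOn (fun f x => f x) (fun _ _ => by simp) ?_
  intro f hf f₁ hf₁ heq
  simp only [coe_filter, mem_univ, true_and, Set.mem_ofPred_eq] at hf hf₁
  ext x
  by_cases hx : x ∈ T
  · exact congrFun heq ⟨x, hx⟩
  · rw [hf x hx, hf₁ x hx]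

/-- Few pairs of a colouring and an index have a large fragment. -/
theorem card_large_fragment_le [Fintype X] [Fintype C] [Fintype ι]
    (g : (X → C) → ι → Finset X) (c : C) (L : ℕ) {κ : ℝ} (hκ0 : 0 < κ)
    (hκ : (Fintype.card C : ℝ) ≤ κ)
    (hinv : ∀ f i T, T ⊆ g f i → g (recolour f T c) = g f)
    (hspread : ∀ f B, (#(univ.filter fun i => B ⊆ g f i) : ℝ) * κ ^ #B ≤ Fintype.card ι) :
    (#(univ.filter fun p : (X → C) × ι => #(g p.1 p.2) < 2 * L ∧
        L ≤ #(fragment (g p.1) (colourClass p.1 c) p.2)) : ℝ) ≤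
      (4 * Fintype.card C / κ) ^ L * (Fintype.card (X → C) * Fintype.card ι) := by
  -- `G f'` is a smallest member inside the class of `c`. It depends on `f'` alone, which makes the
  -- encoding below cheap; `∅` is a dummy value when no small member exists.
  have hG : ∀ f' : X → C, ∃ G : Finset X, #G ≤ 2 * L ∧
      ((∃ j, g f' j ⊆ colourClass f' c ∧ #(g f' j) < 2 * L) →
        ∃ j, G = g f' j ∧ g f' j ⊆ colourClass f' c ∧
          ∀ j', g f' j' ⊆ colourClass f' c → #(g f' j) ≤ #(g f' j')) := by
    intro f'
    by_cases h : ∃ j, g f' j ⊆ colourClass f' c ∧ #(g f' j) < 2 * L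
    · obtain ⟨j₀, h1, h2⟩ := h
      obtain ⟨j, hj, hmin⟩ := exists_min_image
        (univ.filter fun j => g f' j ⊆ colourClass f' c) (fun j => #(g f' j)) ⟨j₀, by simp [h1]⟩
      have hmin' : ∀ j', g f' j' ⊆ colourClass f' c → #(g f' j) ≤ #(g f' j') :=
        fun j' hj' => hmin j' (by simp [hj'])
      exact ⟨g f' j, ((hmin' j₀ h1).trans_lt h2).le,
        fun _ => ⟨j, rfl, by simpa using hj, hmin'⟩⟩
    · exact ⟨∅, by simp, fun h' => absurd h' h⟩
  choose G hG2 hG using hG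
  -- Encode a bad pair `(f, i)` by the colouring `f'` that gives its fragment `T` the colour `c`.
  -- Then `T ⊆ G f'`, which leaves at most 4^L choices of `T`; `f` agrees with `f'` off `T`, and
  -- spreadness bounds the indices `i` with `T ⊆ g f' i`.
  have hsub : (univ.filter fun p : (X → C) × ι => #(g p.1 p.2) < 2 * L ∧
        L ≤ #(fragment (g p.1) (colourClass p.1 c) p.2)) ⊆
      univ.biUnion fun f' : X → C => ((G f').powerset.filter fun T => L ≤ #T).biUnion fun T =>
        (univ.filter fun f : X → C => ∀ x, x ∉ T → f x = f' x) ×ˢ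
          (univ.filter fun i => T ⊆ g f' i) := by
    rintro ⟨f, i⟩ hp
    simp only [mem_filter, mem_univ, true_and] at hp
    obtain ⟨hlt, hL⟩ := hp
    set T := fragment (g f) (colourClass f c) i with hT
    have hTi : T ⊆ g f i := fragment_subset _ _ _
    have hgf : g (recolour f T c) = g f := hinv f i T hTi
    have hW := colourClass_recolour f T c
    obtain ⟨j₁, hj₁, hTj₁⟩ := exists_fragment_eq (g f) (colourClass f c) i
    have hj₁W : g f j₁ ⊆ T ∪ colourClass f c := by
      rw [hT, hTj₁]; simp
    obtain ⟨j, hGj, hjW, hmin⟩ := hG (recolour f T c)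
      ⟨j₁, by rw [hW, hgf]; exact hj₁W, by rw [hgf]; omega⟩
    rw [hgf] at hGj hjW hmin
    rw [hW] at hjW hmin
    have hle : #(g f j) ≤ #(g f i) := (hmin j₁ hj₁W).trans hj₁
    have hsub : g f j \ colourClass f c ⊆ T := by
      intro x hx
      rw [mem_sdiff] at hx
      exact (mem_union.1 (hjW hx.1)).resolve_right hx.2
    -- The chosen member competes in the definition of the fragment of `i`, so its uncovered part
    -- cannot be smaller than `T`.
    have hTeq : g f j \ colourClass f c = T := by
      refine eq_of_subset_of_card_le hsub (card_fragment_le hle (hjW.trans ?_))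
      exact union_subset_union hTi le_rfl
    simp only [mem_biUnion, mem_univ, true_and, mem_filter, mem_powerset, mem_product]
    refine ⟨recolour f T c, T, ⟨?_, hL⟩, ?_, ?_⟩
    · rw [hGj, ← hTeq]; exact sdiff_subset
    · intro x hx
      simp [recolour, hx]
    · rw [hgf]; exact hTi
  have hq0 : 0 ≤ (Fintype.card C : ℝ) / κ := by positivity
  have hq1 : (Fintype.card C : ℝ) / κ ≤ 1 := (div_le_one hκ0).2 hκ
  have hinner : ∀ f' : X → C, ∀ T ∈ (G f').powerset.filter fun T => L ≤ #T,
      (#((univ.filter fun f : X → C => ∀ x, x ∉ T → f x = f' x) ×ˢ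
          (univ.filter fun i => T ⊆ g f' i)) : ℝ) ≤
        ((Fintype.card C : ℝ) / κ) ^ L * Fintype.card ι := by
    intro f' T hT
    simp only [mem_filter] at hT
    rw [card_product, Nat.cast_mul]
    have h1 : (#(univ.filter fun f : X → C => ∀ x, x ∉ T → f x = f' x) : ℝ) ≤
        (Fintype.card C : ℝ) ^ #T := by exact_mod_cast card_agree_off_le f' T
    have h2 : (#(univ.filter fun i => T ⊆ g f' i) : ℝ) ≤ Fintype.card ι / κ ^ #T :=
      (le_div_iff₀ (by positivity)).2 (hspread f' T)
    calc _ ≤ (Fintype.card C : ℝ) ^ #T * (Fintype.card ι / κ ^ #T) := by gcongr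
      _ = ((Fintype.card C : ℝ) / κ) ^ #T * Fintype.card ι := by rw [div_pow]; ring
      _ ≤ _ := by
        gcongr ?_ * _
        exact pow_le_pow_of_le_one hq0 hq1 hT.2
  have hf' : ∀ f' ∈ (univ : Finset (X → C)),
      (#(((G f').powerset.filter fun T => L ≤ #T).biUnion fun T =>
        (univ.filter fun f : X → C => ∀ x, x ∉ T → f x = f' x) ×ˢ
          (univ.filter fun i => T ⊆ g f' i)) : ℝ) ≤
        (4 * Fintype.card C / κ) ^ L * Fintype.card ι := by
    intro f' _
    have hc : (#((G f').powerset.filter fun T => L ≤ #T) : ℝ) ≤ 4 ^ L := by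
      have : #((G f').powerset.filter fun T => L ≤ #T) ≤ 4 ^ L := by
        refine (card_filter_le _ _).trans ?_
        rw [card_powerset]
        refine (Nat.pow_le_pow_right (by norm_num) (hG2 f')).trans ?_
        rw [pow_mul]; norm_num
      exact_mod_cast this
    calc _ ≤ ∑ T ∈ (G f').powerset.filter fun T => L ≤ #T,
        (#((univ.filter fun f : X → C => ∀ x, x ∉ T → f x = f' x) ×ˢ
          (univ.filter fun i => T ⊆ g f' i)) : ℝ) := by exact_mod_cast card_biUnion_le
      _ ≤ ∑ T ∈ (G f').powerset.filter fun T => L ≤ #T,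
          ((Fintype.card C : ℝ) / κ) ^ L * Fintype.card ι := sum_le_sum (hinner f')
      _ = (#((G f').powerset.filter fun T => L ≤ #T) : ℝ) *
          (((Fintype.card C : ℝ) / κ) ^ L * Fintype.card ι) := by
        rw [sum_const, nsmul_eq_mul]
      _ ≤ 4 ^ L * (((Fintype.card C : ℝ) / κ) ^ L * Fintype.card ι) := by gcongr
      _ = _ := by rw [mul_div_assoc, mul_pow]; ring
  calc _ ≤ (#(univ.biUnion fun f' : X → C =>
          ((G f').powerset.filter fun T => L ≤ #T).biUnion fun T =>
        (univ.filter fun f : X → C => ∀ x, x ∉ T → f x = f' x) ×ˢ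
          (univ.filter fun i => T ⊆ g f' i)) : ℝ) := by exact_mod_cast card_le_card hsub
    _ ≤ ∑ f' : X → C, (#(((G f').powerset.filter fun T => L ≤ #T).biUnion fun T =>
        (univ.filter fun f : X → C => ∀ x, x ∉ T → f x = f' x) ×ˢ
          (univ.filter fun i => T ⊆ g f' i)) : ℝ) := by exact_mod_cast card_biUnion_le
    _ ≤ ∑ f' : X → C, (4 * Fintype.card C / κ) ^ L * (Fintype.card ι : ℝ) := sum_le_sum hf'
    _ = _ := by rw [sum_const, nsmul_eq_mul, card_univ]; ring

/-- Few pairs are left uncovered after one round for each colour of the list. -/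
theorem card_uncovered_le [Fintype X] [Fintype C] [Fintype ι] {κ : ℝ} (hκ0 : 0 < κ)
    (hκ : (Fintype.card C : ℝ) ≤ κ) (l : List C) (hl : l.Nodup)
    (g : (X → C) → ι → Finset X)
    (hinv : ∀ c ∈ l, ∀ f i T, T ⊆ g f i → g (recolour f T c) = g f)
    (hspread : ∀ f B, (#(univ.filter fun i => B ⊆ g f i) : ℝ) * κ ^ #B ≤ Fintype.card ι) :
    (#(univ.filter fun p : (X → C) × ι => #(g p.1 p.2) < 2 ^ l.length ∧
        ¬ ∃ j, ∀ x ∈ g p.1 j, p.1 x ∈ l) : ℝ) ≤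
      (∑ a ∈ range l.length, (4 * Fintype.card C / κ) ^ (2 ^ a)) *
        (Fintype.card (X → C) * Fintype.card ι) := by
  induction l generalizing g with
  | nil =>
    rw [filter_false_of_mem]
    · simp
    · rintro ⟨f, i⟩ _ ⟨h1, h2⟩
      -- With no colours left the size bound is 2^0, so the set is empty and vacuously covered.
      refine h2 ⟨i, ?_⟩
      have : g f i = ∅ := by
        rw [← card_eq_zero]; simpa using h1
      simp [this]
  | cons c l ih =>
    rw [List.nodup_cons] at hl
    have h1 := card_large_fragment_le g c (2 ^ l.length) hκ0 hκ
      (hinv c (by simp)) hspread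
    have h2 := ih hl.2 (fun f => fragment (g f) (colourClass f c)) ?_ ?_
    · rw [List.length_cons, sum_range_succ, add_mul]
      refine le_trans ?_ (add_le_add h2 h1)
      rw [← Nat.cast_add, Nat.cast_le]
      refine le_trans (card_le_card ?_) (card_union_le _ _)
      rintro ⟨f, i⟩ hp
      simp only [mem_filter, mem_univ, true_and, mem_union] at hp ⊢
      obtain ⟨hlt, hno⟩ := hp
      rw [pow_succ'] at hlt
      -- Either the fragment failed to halve, which `h1` counts, or it is small enough for the
      -- induction on the remaining colours.
      by_cases hL : 2 ^ l.length ≤ #(fragment (g f) (colourClass f c) i)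
      · exact Or.inr ⟨hlt, hL⟩
      · refine Or.inl ⟨not_le.1 hL, ?_⟩
        rintro ⟨j, hj⟩
        obtain ⟨j', -, hj'⟩ := exists_fragment_eq (g f) (colourClass f c) j
        refine hno ⟨j', fun x hx => ?_⟩
        by_cases hxc : f x = c
        · simp [hxc]
        · refine List.mem_cons_of_mem _ (hj x ?_)
          rw [hj', mem_sdiff]
          exact ⟨hx, by simp [colourClass, hxc]⟩
    · intro c' hc' f i T hT
      have hne : c ≠ c' := fun h => hl.1 (h ▸ hc')
      have e1 : g (recolour f T c') = g f :=
        hinv c' (List.mem_cons_of_mem _ hc') f i T (hT.trans (fragment_subset _ _ _))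
      have e2 : colourClass (recolour f T c') c = colourClass f c :=
        colourClass_recolour_of_ne f hne fun x hx => notMem_of_mem_fragment (hT hx)
      simp only [e1, e2]
    -- Spreadness passes to fragments because each lies in its original set.
    · intro f B
      refine le_trans ?_ (hspread f B)
      refine mul_le_mul_of_nonneg_right (Nat.cast_le.2 (card_le_card fun i hi => ?_))
        (by positivity)
      rw [mem_filter] at hi ⊢
      exact ⟨hi.1, hi.2.trans (fragment_subset _ _ _)⟩

theorem sum_pow_two_pow_le {θ : ℝ} (h0 : 0 ≤ θ) (h1 : θ ≤ 1 / 2) (k : ℕ) :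
    ∑ a ∈ range k, θ ^ (2 ^ a) ≤ 2 * θ := by
  have key : ∀ k : ℕ, ∑ a ∈ range k, θ ^ (2 ^ a) ≤ 2 * θ * (1 - (1 / 2) ^ k) := by
    intro k
    induction k with
    | zero => simp
    | succ k ih =>
      rw [sum_range_succ]
      have h2 : θ ^ (2 ^ k) ≤ θ * (1 / 2) ^ k := by
        have : k + 1 ≤ 2 ^ k := Nat.lt_two_pow_self
        calc θ ^ (2 ^ k) ≤ θ ^ (k + 1) := pow_le_pow_of_le_one h0 (by linarith) this
          _ = θ * θ ^ k := by ring
          _ ≤ _ := by gcongr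
      have h3 : ((1 : ℝ) / 2) ^ (k + 1) = (1 / 2) ^ k / 2 := by ring
      rw [h3]
      linarith
  refine (key k).trans ?_
  have : 0 ≤ ((1 : ℝ) / 2) ^ k := by positivity
  nlinarith

/-- A sufficiently spread family of small sets has `r` pairwise disjoint members. -/
theorem exists_pairwise_disjoint_of_spread [Fintype X] [Fintype ι] [Nonempty ι] (S : ι → Finset X)
    (r k : ℕ) (hr : 0 < r) (hk : 0 < k) {κ : ℝ} (hκ : 16 * (r : ℝ) ^ 2 * k ≤ κ)
    (hcard : ∀ i, #(S i) < 2 ^ k)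
    (hspread : ∀ B, (#(univ.filter fun i => B ⊆ S i) : ℝ) * κ ^ #B ≤ Fintype.card ι) :
    ∃ i : Fin r → ι, ∀ a b, a ≠ b → Disjoint (S (i a)) (S (i b)) := by
  have hr1 : (1 : ℝ) ≤ r := by exact_mod_cast hr
  have hk1 : (1 : ℝ) ≤ k := by exact_mod_cast hk
  have hκ0 : 0 < κ := lt_of_lt_of_le (by positivity) hκ
  have hC : (Fintype.card (Fin r × Fin k) : ℝ) = r * k := by simp
  have hrk : (r : ℝ) * k ≤ (r : ℝ) ^ 2 * k := by
    gcongr; nlinarith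
  have hrk0 : 0 < (r : ℝ) * k := by positivity
  have hCκ : (Fintype.card (Fin r × Fin k) : ℝ) ≤ κ := by rw [hC]; nlinarith
  set θ : ℝ := 4 * Fintype.card (Fin r × Fin k) / κ with hθ
  have hθ0 : 0 ≤ θ := by positivity
  have hθr : θ * r ≤ 1 / 4 := by
    rw [hθ, hC, div_mul_eq_mul_div, div_le_iff₀ hκ0]
    nlinarith
  have hθ1 : θ ≤ 1 / 2 := by nlinarith
  have hι : (0 : ℝ) < Fintype.card ι := by exact_mod_cast Fintype.card_pos
  have : Nonempty (Fin r × Fin k) := ⟨⟨⟨0, hr⟩, ⟨0, hk⟩⟩⟩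
  have hF : (0 : ℝ) < Fintype.card (X → Fin r × Fin k) := by exact_mod_cast Fintype.card_pos
  have hbad : ∀ a : Fin r, (#(univ.filter fun f : X → Fin r × Fin k =>
      ¬ ∃ j, ∀ x ∈ S j, (f x).1 = a) : ℝ) ≤ 2 * θ * Fintype.card (X → Fin r × Fin k) := by
    intro a
    set l : List (Fin r × Fin k) := (List.finRange k).map fun b => (a, b) with hl
    have hnd : l.Nodup := (List.nodup_finRange k).map fun b b' h => (Prod.mk.inj h).2
    have hlen : l.length = k := by simp [hl]
    have hmem : ∀ q : Fin r × Fin k, q ∈ l ↔ q.1 = a := by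
      rintro ⟨q1, q2⟩
      simp [hl, eq_comm]
    have h := card_uncovered_le hκ0 hCκ l hnd (fun _ => S) (by simp) (fun _ B => hspread B)
    rw [hlen] at h
    -- Whether a colour contains a member does not involve the index, so the factor `Fintype.card ι`
    -- cancels.
    have h' : (#((univ.filter fun f : X → Fin r × Fin k =>
        ¬ ∃ j, ∀ x ∈ S j, (f x).1 = a) ×ˢ (univ : Finset ι)) : ℝ) ≤
        (∑ a ∈ range k, θ ^ (2 ^ a)) *
          (Fintype.card (X → Fin r × Fin k) * Fintype.card ι) := by
      refine le_trans (Nat.cast_le.2 (card_le_card ?_)) h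
      rintro ⟨f, i⟩ hp
      simpa [hcard, hmem] using hp
    rw [card_product, Nat.cast_mul, card_univ, ← mul_assoc] at h'
    refine (le_of_mul_le_mul_right h' hι).trans ?_
    gcongr
    exact sum_pow_two_pow_le hθ0 hθ1 k
  -- Union bound over the r colours: the failing proportion is at most 2θr ≤ 1/2.
  have hex : ∃ f : X → Fin r × Fin k, ∀ a, ∃ j, ∀ x ∈ S j, (f x).1 = a := by
    by_contra hcon
    push Not at hcon
    have hcov : (univ : Finset (X → Fin r × Fin k)) ⊆ univ.biUnion fun a : Fin r =>
        univ.filter fun f : X → Fin r × Fin k => ¬ ∃ j, ∀ x ∈ S j, (f x).1 = a := by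
      intro f _
      obtain ⟨a, ha⟩ := hcon f
      simp only [mem_biUnion, mem_univ, true_and, mem_filter]
      refine ⟨a, ?_⟩
      push Not
      exact ha
    have h1 : (Fintype.card (X → Fin r × Fin k) : ℝ) ≤
        ∑ a : Fin r, 2 * θ * Fintype.card (X → Fin r × Fin k) := by
      refine le_trans ?_ (sum_le_sum fun a _ => hbad a)
      rw [← card_univ]
      exact_mod_cast (card_le_card hcov).trans card_biUnion_le
    rw [sum_const, nsmul_eq_mul, card_univ, Fintype.card_fin] at h1
    nlinarith
  obtain ⟨f, hf⟩ := hex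
  choose i hi using hf
  refine ⟨i, fun a b hab => disjoint_left.2 fun x hxa hxb => hab ?_⟩
  rw [← hi a x hxa, hi b x hxb]

end Spread

/-! ### The sunflower lemma. -/

section Sunflower

open Finset
open scoped Classical

/-- The improved sunflower lemma: a large uniform family contains a sunflower with `r` petals. -/
theorem exists_sunflower {X : Type*} [Fintype X] (𝓕 : Finset (Finset X)) (m r k : ℕ)
    (hr : 0 < r) (hm : ∀ S ∈ 𝓕, #S = m) (hmk : m < 2 ^ k) {κ : ℝ} (hk : 0 < k)
    (hκ : 16 * (r : ℝ) ^ 2 * k ≤ κ) (hcard : κ ^ m < #𝓕) :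
    ∃ (A : Finset X) (S : Fin r → Finset X), (∀ a, S a ∈ 𝓕 ∧ A ⊂ S a) ∧
      ∀ a b, a ≠ b → Disjoint (S a \ A) (S b \ A) := by
  have hr1 : (1 : ℝ) ≤ r := by exact_mod_cast hr
  have hk1 : (1 : ℝ) ≤ k := by exact_mod_cast hk
  have hκ0 : 0 < κ := lt_of_lt_of_le (by positivity) hκ
  -- Maximality of this weight at `A` is exactly the spreadness of the link of `A`.
  obtain ⟨A, -, hA⟩ := exists_max_image (univ : Finset (Finset X))
    (fun A => (#(𝓕.filter (A ⊆ ·)) : ℝ) * κ ^ #A) ⟨∅, mem_univ _⟩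
  have hlarge : κ ^ m < #(𝓕.filter (A ⊆ ·)) * κ ^ #A := by
    have := hA ∅ (mem_univ _)
    simp only [empty_subset, filter_true, card_empty, pow_zero, mul_one] at this
    exact hcard.trans_le this
  have hne : (𝓕.filter (A ⊆ ·)).Nonempty := by
    rw [nonempty_iff_ne_empty]
    intro h
    rw [h, card_empty, Nat.cast_zero, zero_mul] at hlarge
    exact absurd hlarge (not_lt.2 (by positivity))
  have hssub : ∀ S ∈ 𝓕.filter (A ⊆ ·), A ⊂ S := by
    intro S hS
    rw [mem_filter] at hS
    -- If `A` were itself a member, uniformity would make it the only one above `A`, of weight κ^m,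
    -- against `hlarge`.
    refine hS.2.ssubset_of_ne fun h => ?_
    have hAm : #A = m := by rw [h]; exact hm S hS.1
    have h1 : 𝓕.filter (A ⊆ ·) ⊆ {A} := by
      intro S' hS'
      rw [mem_filter] at hS'
      rw [mem_singleton]
      exact (eq_of_subset_of_card_le hS'.2 (by rw [hm S' hS'.1, hAm])).symm
    have h2 : (#(𝓕.filter (A ⊆ ·)) : ℝ) ≤ 1 := by exact_mod_cast card_le_card h1
    rw [hAm] at hlarge
    have : 0 < κ ^ m := by positivity
    nlinarith
  have : Nonempty (𝓕.filter (A ⊆ ·)) := hne.to_subtype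
  have hsmall : ∀ S : 𝓕.filter (A ⊆ ·), #((S : Finset X) \ A) < 2 ^ k := fun S =>
    (card_le_card sdiff_subset).trans_lt (by rwa [hm _ (mem_filter.1 S.2).1])
  have hspread : ∀ B, (#(univ.filter fun S : 𝓕.filter (A ⊆ ·) => B ⊆ (S : Finset X) \ A) : ℝ) *
      κ ^ #B ≤ Fintype.card (𝓕.filter (A ⊆ ·)) := by
    intro B
    rw [Fintype.card_coe]
    by_cases hB : Disjoint A B
    · have h1 : #(univ.filter fun S : 𝓕.filter (A ⊆ ·) => B ⊆ (S : Finset X) \ A) ≤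
          #(𝓕.filter (A ∪ B ⊆ ·)) := by
        refine card_le_card_of_injOn (fun S => (S : Finset X)) ?_
          (Subtype.val_injective.injOn)
        intro S hS
        have hS2 := mem_filter.1 S.2
        simp only [coe_filter, mem_univ, true_and, Set.mem_ofPred_eq] at hS ⊢
        exact ⟨hS2.1, union_subset hS2.2 (hS.trans sdiff_subset)⟩
      have h2 := hA (A ∪ B) (mem_univ _)
      rw [card_union_of_disjoint hB, pow_add, mul_comm (κ ^ #A), ← mul_assoc] at h2
      refine le_trans ?_ (le_of_mul_le_mul_right h2 (by positivity))
      gcongr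
    · have h1 : (univ.filter fun S : 𝓕.filter (A ⊆ ·) => B ⊆ (S : Finset X) \ A) = ∅ := by
        refine filter_eq_empty_iff.2 fun S _ hS => hB ?_
        exact disjoint_right.2 fun x hx => (mem_sdiff.1 (hS hx)).2
      rw [h1]
      simp
  obtain ⟨i, hi⟩ := exists_pairwise_disjoint_of_spread
    (fun S : 𝓕.filter (A ⊆ ·) => (S : Finset X) \ A) r k hr hk hκ hsmall hspread
  exact ⟨A, fun a => i a, fun a => ⟨(mem_filter.1 (i a).2).1, hssub _ (i a).2⟩, hi⟩

end Sunflower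

/-! ### Counting matchings, and regularity from a sunflower. -/

namespace MultiHypergraph

open Finset
open scoped Classical

variable {V E : Type*}

/-- The vertices covered by a set of edges. -/
def cover [DecidableEq V] (H : MultiHypergraph V E) (M : Finset E) : Finset V :=
  M.biUnion H.edgeVerts

/-- The matchings with `m` edges. -/
noncomputable def matchings [Fintype E] (H : MultiHypergraph V E) (m : ℕ) : Finset (Finset E) :=
  univ.filter fun M => #M = m ∧ (M : Set E).PairwiseDisjoint H.edgeVerts

theorem mem_matchings [Fintype E] {H : MultiHypergraph V E} {m : ℕ} {M : Finset E} :
    M ∈ H.matchings m ↔ #M = m ∧ (M : Set E).PairwiseDisjoint H.edgeVerts := by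
  simp [matchings]

variable [DecidableEq V] [Fintype E]

theorem card_cover {H : MultiHypergraph V E} {r m : ℕ} (hH : H.IsUniform r) {M : Finset E}
    (hM : M ∈ H.matchings m) : #(H.cover M) = r * m := by
  rw [mem_matchings] at hM
  rw [cover, card_biUnion fun x hx y hy hxy => hM.2 hx hy hxy, sum_congr rfl fun e _ => hH e,
    sum_const, hM.1, smul_eq_mul, mul_comm]

theorem degree_le_maxDegree [Fintype V] (H : MultiHypergraph V E) (v : V) : H.degree v ≤ H.maxDegree :=
  le_sup (f := H.degree) (mem_univ v)

/-- Double counting of the incident pairs of a uniform hypergraph. -/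
theorem sum_degree [Fintype V] {H : MultiHypergraph V E} {r : ℕ} (hH : H.IsUniform r) :
    ∑ v, H.degree v = Fintype.card E * r := by
  have h := sum_card_bipartiteAbove_eq_sum_card_bipartiteBelow (s := (univ : Finset V))
    (t := (univ : Finset E)) (fun v e => v ∈ H.edgeVerts e)
  have h2 : ∀ e : E, #(bipartiteBelow (fun v e => v ∈ H.edgeVerts e) (univ : Finset V) e) = r := by
    intro e
    rw [← hH e]
    congr 1
    ext v
    simp [bipartiteBelow]
  simp only [h2, sum_const, card_univ, smul_eq_mul] at h
  rw [← h]
  rfl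

theorem card_le_card_extensions [Fintype V] {H : MultiHypergraph V E} {r m : ℕ} (hH : H.IsUniform r)
    {M : Finset E} (hM : M ∈ H.matchings m) :
    Fintype.card E ≤ #(univ.filter fun e => Disjoint (H.edgeVerts e) (H.cover M)) +
      r * m * H.maxDegree := by
  rw [← card_univ, ← card_filter_add_card_filter_not
    (s := univ) (fun e => Disjoint (H.edgeVerts e) (H.cover M))]
  gcongr
  rw [← card_cover hH hM]
  refine le_trans (card_le_card ?_) (card_biUnion_le_card_mul (H.cover M)
    (fun v => univ.filter fun e => v ∈ H.edgeVerts e) H.maxDegree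
    fun v _ => H.degree_le_maxDegree v)
  intro e he
  simp only [mem_filter, mem_univ, true_and, not_disjoint_iff] at he
  obtain ⟨v, hv1, hv2⟩ := he
  simp only [mem_biUnion, mem_filter, mem_univ, true_and]
  exact ⟨v, hv2, hv1⟩

theorem insert_mem_matchings {H : MultiHypergraph V E} {r m : ℕ} (hr : 0 < r)
    (hH : H.IsUniform r) {M : Finset E} (hM : M ∈ H.matchings m) {e : E}
    (he : Disjoint (H.edgeVerts e) (H.cover M)) : e ∉ M ∧ insert e M ∈ H.matchings (m + 1) := by
  have hdis : ∀ e' ∈ M, Disjoint (H.edgeVerts e) (H.edgeVerts e') := fun e' he' =>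
    he.mono_right (subset_biUnion_of_mem H.edgeVerts he')
  have heM : e ∉ M := by
    intro h
    have h1 := hdis e h
    rw [disjoint_self_iff_empty, ← card_eq_zero, hH e] at h1
    omega
  rw [mem_matchings] at hM
  refine ⟨heM, mem_matchings.2 ⟨by rw [card_insert_of_notMem heM, hM.1], ?_⟩⟩
  rw [coe_insert]
  exact hM.2.insert fun e' he' _ => hdis e' he'

/-- Double counting of pairs M ⊆ M': each M extends in at least q ways, and each M' contains at most
m + 1 matchings with m edges. -/
theorem card_matchings_step [Fintype V] {H : MultiHypergraph V E} {r m : ℕ} (hr : 0 < r)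
    (hH : H.IsUniform r) {q : ℝ}
    (hq : q + r * m * H.maxDegree ≤ Fintype.card E) :
    #(H.matchings m) * q ≤ #(H.matchings (m + 1)) * ((m + 1 : ℕ) : ℝ) := by
  have h := card_nsmul_le_card_nsmul (R := ℝ) (s := H.matchings m) (t := H.matchings (m + 1))
    (m := q) (n := ((m + 1 : ℕ) : ℝ)) (fun M M' => M ⊆ M') ?_ ?_
  · rwa [nsmul_eq_mul, nsmul_eq_mul] at h
  · intro M hM
    have h1 : (Fintype.card E : ℝ) ≤
        #(univ.filter fun e => Disjoint (H.edgeVerts e) (H.cover M)) + r * m * H.maxDegree := by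
      exact_mod_cast card_le_card_extensions hH hM
    have h2 : #(univ.filter fun e => Disjoint (H.edgeVerts e) (H.cover M)) ≤
        #(bipartiteAbove (fun M M' => M ⊆ M') (H.matchings (m + 1)) M) := by
      refine card_le_card_of_injOn (fun e => insert e M) ?_ ?_
      · intro e he
        simp only [coe_filter, mem_univ, true_and, Set.mem_ofPred_eq] at he
        rw [mem_coe, mem_bipartiteAbove]
        exact ⟨(insert_mem_matchings hr hH hM he).2, subset_insert _ _⟩
      · intro e he e' he' heq
        simp only [coe_filter, mem_univ, true_and, Set.mem_ofPred_eq] at he he'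
        have h3 : e ∈ insert e' M := by
          rw [← show insert e M = insert e' M from heq]; exact mem_insert_self _ _
        exact (mem_insert.1 h3).resolve_right (insert_mem_matchings hr hH hM he).1
    have h2' := (Nat.cast_le (α := ℝ)).2 h2
    linarith
  · intro M' hM'
    rw [mem_matchings] at hM'
    have h1 : #(bipartiteBelow (fun M M' => M ⊆ M') (H.matchings m) M') ≤ m + 1 := by
      calc _ ≤ #(powersetCard m M') := by
            refine card_le_card fun M hM => ?_
            rw [mem_bipartiteBelow, mem_matchings] at hM
            exact mem_powersetCard.2 ⟨hM.2, hM.1.1⟩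
        _ = m + 1 := by rw [card_powersetCard, hM'.1, Nat.choose_succ_self_right]
    exact_mod_cast h1

/-- A greedy lower bound for the number of matchings. -/
theorem pow_le_card_matchings [Fintype V] {H : MultiHypergraph V E} {r : ℕ} (hr : 0 < r)
    (hH : H.IsUniform r) {q : ℝ} (hq0 : 0 ≤ q) (m : ℕ)
    (hq : ∀ i < m, q + r * i * H.maxDegree ≤ Fintype.card E) :
    q ^ m ≤ #(H.matchings m) * (m.factorial : ℝ) := by
  induction m with
  | zero =>
    have : (∅ : Finset E) ∈ H.matchings 0 := mem_matchings.2 (by simp)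
    have h : 1 ≤ #(H.matchings 0) := card_pos.2 ⟨_, this⟩
    simpa using h
  | succ m ih =>
    have h1 := ih fun i hi => hq i (by omega)
    have h2 := card_matchings_step hr hH (hq m (by omega))
    calc q ^ (m + 1) = q ^ m * q := pow_succ _ _
      _ ≤ #(H.matchings m) * (m.factorial : ℝ) * q := by gcongr
      _ = #(H.matchings m) * q * (m.factorial : ℝ) := by ring
      _ ≤ #(H.matchings (m + 1)) * ((m + 1 : ℕ) : ℝ) * (m.factorial : ℝ) := by gcongr
      _ = _ := by rw [Nat.factorial_succ]; push_cast; ring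

/-- Removing its kernel from a sunflower of matchings that cover the same vertices leaves a regular
subhypergraph. -/
theorem exists_regular_of_sunflower {H : MultiHypergraph V E} {r m : ℕ} (hr : 0 < r)
    (hH : H.IsUniform r) {W : Finset V} {A : Finset E} {S : Fin r → Finset E}
    (hS : ∀ a, S a ∈ H.matchings m ∧ H.cover (S a) = W) (hA : ∀ a, A ⊂ S a)
    (hdis : ∀ a b, a ≠ b → Disjoint (S a \ A) (S b \ A)) :
    ∃ K : H.Sub, K.verts.Nonempty ∧ K.IsRegular r := by
  have hpd : ∀ a, ((S a : Finset E) : Set E).PairwiseDisjoint H.edgeVerts := fun a =>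
    (mem_matchings.1 (hS a).1).2
  -- An edge outside the kernel belongs to a matching that contains the kernel, so it avoids the
  -- vertices of `A`.
  have hsub : ∀ e ∈ univ.biUnion (fun a => S a \ A), H.edgeVerts e ⊆ W \ H.cover A := by
    intro e he v hv
    simp only [mem_biUnion, mem_univ, true_and, mem_sdiff] at he
    obtain ⟨a, hea, heA⟩ := he
    refine mem_sdiff.2 ⟨?_, fun hvA => ?_⟩
    · rw [← (hS a).2]
      exact mem_biUnion.2 ⟨e, hea, hv⟩
    · obtain ⟨e', he', hv'⟩ := mem_biUnion.1 hvA
      have hne : e ≠ e' := fun h => heA (h ▸ he')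
      exact disjoint_left.1 (hpd a hea ((hA a).1 he') hne) hv hv'
  refine ⟨⟨W \ H.cover A, univ.biUnion fun a => S a \ A, hsub⟩, ?_, ?_⟩
  · obtain ⟨e, he, heA⟩ := exists_of_ssubset (hA ⟨0, hr⟩)
    have hne : (H.edgeVerts e).Nonempty := by
      rw [← card_pos, hH e]; exact hr
    exact hne.mono (hsub e (mem_biUnion.2 ⟨⟨0, hr⟩, mem_univ _, mem_sdiff.2 ⟨he, heA⟩⟩))
  · intro v hv
    simp only [mem_sdiff] at hv
    -- Each matching covers v by exactly one edge, which is not in the kernel; disjointness of the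
    -- petals lets these r contributions add up.
    have hone : ∀ a, #((S a \ A).filter fun e => v ∈ H.edgeVerts e) = 1 := by
      intro a
      have hvW := hv.1
      rw [← (hS a).2] at hvW
      obtain ⟨e, he, hve⟩ := mem_biUnion.1 hvW
      rw [card_eq_one]
      refine ⟨e, ?_⟩
      ext e'
      simp only [mem_filter, mem_sdiff, mem_singleton]
      constructor
      · rintro ⟨⟨he', -⟩, hve'⟩
        by_contra hne
        exact disjoint_left.1 (hpd a he' he hne) hve' hve
      · rintro rfl
        exact ⟨⟨he, fun heA => hv.2 (mem_biUnion.2 ⟨e', heA, hve⟩)⟩, hve⟩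
    rw [Sub.degree]
    simp only [filter_biUnion]
    rw [card_biUnion]
    · simp only [hone, sum_const, card_univ, Fintype.card_fin, smul_eq_mul, mul_one]
    · intro a _ b _ hab
      exact disjoint_filter_filter (hdis a b hab)

/-- Many matchings of the same size force a regular subhypergraph. -/
theorem exists_regular_of_card_matchings [Fintype V] {H : MultiHypergraph V E} {r m k : ℕ} (hr : 0 < r)
    (hH : H.IsUniform r) (hmk : m < 2 ^ k) (hk : 0 < k) {κ : ℝ}
    (hκ : 16 * (r : ℝ) ^ 2 * k ≤ κ)
    (hcard : ((Fintype.card V).choose (r * m) : ℝ) * κ ^ m < #(H.matchings m)) :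
    ∃ K : H.Sub, K.verts.Nonempty ∧ K.IsRegular r := by
  obtain ⟨W, -, hW⟩ := exists_lt_card_fiber_of_nsmul_lt_card_of_maps_to
    (s := H.matchings m) (t := powersetCard (r * m) (univ : Finset V)) (f := H.cover) (b := κ ^ m)
    (fun M hM => mem_powersetCard.2 ⟨subset_univ _, card_cover hH hM⟩)
    (by rwa [card_powersetCard, nsmul_eq_mul, card_univ])
  obtain ⟨A, S, hS, hdis⟩ := exists_sunflower ((H.matchings m).filter fun M => H.cover M = W)
    m r k hr (fun M hM => (mem_matchings.1 (mem_filter.1 hM).1).1) hmk hk hκ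
    (by convert hW)
  exact exists_regular_of_sunflower hr hH (fun a => mem_filter.1 (hS a).1) (fun a => (hS a).2) hdis

end MultiHypergraph

/-! ### Numerical estimates and the hypergraph form. -/

namespace MultiHypergraph

/-- The threshold is 2304 = 16 · 144: the polynomial factor (8r)^4 is absorbed into 16^r. -/
theorem pow_self_lower_bound {r : ℕ} (hr : 2304 ≤ r) :
    4096 * (r : ℝ) ^ 4 * (144 * (r : ℝ) ^ 2) ^ r ≤ (r : ℝ) ^ (3 * r) := by
  have hr' : (2304 : ℝ) ≤ r := by exact_mod_cast hr
  have h1 : ∀ n : ℕ, 8 ≤ n → 8 * n ≤ 2 ^ n := by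
    intro n hn
    induction n, hn using Nat.le_induction with
    | base => norm_num
    | succ n hn ih => rw [pow_succ]; omega
  have h2 : 8 * (r : ℝ) ≤ 2 ^ r := by exact_mod_cast h1 r (by omega)
  have h3 : 4096 * (r : ℝ) ^ 4 ≤ 16 ^ r := by
    calc 4096 * (r : ℝ) ^ 4 = (8 * r) ^ 4 := by ring
      _ ≤ (2 ^ r) ^ 4 := by gcongr
      _ = 16 ^ r := by rw [← pow_mul, mul_comm, pow_mul]; norm_num
  calc 4096 * (r : ℝ) ^ 4 * (144 * (r : ℝ) ^ 2) ^ r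
      ≤ 16 ^ r * (144 * (r : ℝ) ^ 2) ^ r := by gcongr
    _ = (2304 * (r : ℝ) ^ 2) ^ r := by rw [← mul_pow]; ring
    _ ≤ (r * (r : ℝ) ^ 2) ^ r := by gcongr
    _ = (r : ℝ) ^ (3 * r) := by rw [pow_mul]; ring

theorem div_three_pow_le_factorial (n : ℕ) : ((n : ℝ) / 3) ^ n ≤ n.factorial := by
  have h1 := Real.pow_div_factorial_le_exp (n : ℝ) (by positivity) n
  have h2 : Real.exp n ≤ 3 ^ n := by
    rw [← Real.exp_one_pow]
    gcongr
    exact Real.exp_one_lt_three.le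
  rw [div_le_iff₀ (by positivity)] at h1
  rw [div_pow, div_le_iff₀ (by positivity), mul_comm]
  exact h1.trans (by gcongr)

/-- There are fewer vertex sets than matchings. -/
theorem choose_mul_pow_lt {N r m : ℕ} {d D κ M : ℝ} (hN : 0 < N) (hr : 0 < r) (hm : 0 < m)
    (hD : 1 ≤ D) (hκ0 : 0 ≤ κ) (hNm : (N : ℝ) ≤ 4 * r ^ 2 * D * m)
    (hκ : (12 * r) ^ r * D ^ r * κ < d)
    (hM : (d * N / (2 * r)) ^ m ≤ M * m.factorial) :
    (N.choose (r * m) : ℝ) * κ ^ m < M := by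
  have hN' : (0 : ℝ) < N := by exact_mod_cast hN
  have hr' : (1 : ℝ) ≤ r := by exact_mod_cast hr
  have hm' : (0 : ℝ) < m := by exact_mod_cast hm
  have hf : ((r * m : ℕ) / 3 : ℝ) ^ (r * m) ≤ (r * m).factorial := div_three_pow_le_factorial _
  have hmf : (m.factorial : ℝ) ≤ (m : ℝ) ^ m := by exact_mod_cast Nat.factorial_le_pow m
  -- The m-th root of the desired inequality, after m! ≤ m^m and (rm)! ≥ (rm/3)^(rm). One factor N
  -- cancels, and the others are replaced through N ≤ 4r²Dm = 12rD · (rm/3).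
  have hbase : (N : ℝ) ^ r * κ * m < d * N / (2 * r) * ((r * m : ℕ) / 3 : ℝ) ^ r := by
    have e1 : (N : ℝ) ^ r = N * N ^ (r - 1) := by
      rw [← pow_succ']; congr 1; omega
    have e2 : (4 * (r : ℝ) ^ 2 * D * m) ^ (r - 1) * (4 * r ^ 2 * D * m) =
        (4 * (r : ℝ) ^ 2 * D * m) ^ r := by
      rw [← pow_succ]; congr 1; omega
    have h2r : 2 * (r : ℝ) ≤ 4 * r ^ 2 * D := by nlinarith [mul_le_mul hr' hD]
    have h3 : (N : ℝ) ^ (r - 1) * (2 * r * m) ≤ (4 * (r : ℝ) ^ 2 * D * m) ^ r := by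
      rw [← e2]; gcongr
    have e3 : (4 * (r : ℝ) ^ 2 * D * m) ^ r =
        (12 * r) ^ r * D ^ r * ((r * m : ℕ) / 3 : ℝ) ^ r := by
      rw [← mul_pow, ← mul_pow]; push_cast; congr 1; ring
    rw [e1]
    have hpos : 0 < ((r * m : ℕ) / 3 : ℝ) ^ r := by push_cast; positivity
    have h4 : (N : ℝ) ^ (r - 1) * (2 * r * m) * κ < d * ((r * m : ℕ) / 3 : ℝ) ^ r := by
      calc (N : ℝ) ^ (r - 1) * (2 * r * m) * κ
          ≤ (12 * r) ^ r * D ^ r * ((r * m : ℕ) / 3 : ℝ) ^ r * κ := by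
            rw [← e3]; gcongr
        _ = (12 * r) ^ r * D ^ r * κ * ((r * m : ℕ) / 3 : ℝ) ^ r := by ring
        _ < _ := by gcongr
    rw [div_mul_eq_mul_div, lt_div_iff₀ (by positivity)]
    calc (N : ℝ) * N ^ (r - 1) * κ * m * (2 * r)
        = N * (N ^ (r - 1) * (2 * r * m) * κ) := by ring
      _ < N * (d * ((r * m : ℕ) / 3 : ℝ) ^ r) := by gcongr
      _ = _ := by ring
  have hpow : (N : ℝ) ^ (r * m) * κ ^ m * (m : ℝ) ^ m <
      (d * N / (2 * r)) ^ m * ((r * m : ℕ) / 3 : ℝ) ^ (r * m) := by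
    rw [pow_mul, pow_mul, ← mul_pow, ← mul_pow, ← mul_pow]
    exact pow_lt_pow_left₀ hbase (by positivity) hm.ne'
  have hM0 : 0 ≤ M := by
    by_contra hneg
    have h0 : 0 ≤ (d * N / (2 * r)) ^ m := by
      have : 0 ≤ d := le_trans (by positivity) hκ.le
      positivity
    have : M * m.factorial < 0 := mul_neg_of_neg_of_pos (not_le.1 hneg) (by positivity)
    linarith
  have hfac : 0 < ((r * m).factorial : ℝ) := by positivity
  have hmm : (0 : ℝ) < (m : ℝ) ^ m := by positivity
  have hlt : (N : ℝ) ^ (r * m) * κ ^ m * (m : ℝ) ^ m < M * (r * m).factorial * (m : ℝ) ^ m := by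
    calc _ < (d * N / (2 * r)) ^ m * ((r * m : ℕ) / 3 : ℝ) ^ (r * m) := hpow
      _ ≤ M * m.factorial * (r * m).factorial := by gcongr
      _ ≤ M * (m : ℝ) ^ m * (r * m).factorial := by gcongr
      _ = _ := by ring
  have hlt' := lt_of_mul_lt_mul_right hlt hmm.le
  calc (N.choose (r * m) : ℝ) * κ ^ m
      ≤ (N : ℝ) ^ (r * m) / (r * m).factorial * κ ^ m := by
        gcongr
        exact Nat.choose_le_pow_div (r * m) N
    _ < M := by
        rw [div_mul_eq_mul_div, div_lt_iff₀ hfac]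
        exact hlt'

theorem exists_regular_of_avgDegree {V E : Type*} [Fintype V] [DecidableEq V] [Fintype E]
    (H : MultiHypergraph V E) {r : ℕ} (hr : 2304 ≤ r) (hN : 2 ≤ Fintype.card V)
    (hH : H.IsUniform r)
    (hΔ : (H.maxDegree : ℝ) ≤ H.avgDegree ^ (1 + 1 / (2 * (r : ℝ))))
    (hd : (r : ℝ) ^ (3 * r) * (Real.logb 2 (Fintype.card V : ℝ)) ^ 2 ≤ H.avgDegree) :
    ∃ K : H.Sub, K.verts.Nonempty ∧ K.IsRegular r := by
  set N := Fintype.card V with hNdef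
  set d := H.avgDegree with hddef
  set Λ := Real.logb 2 (N : ℝ) with hΛ
  have hN' : (2 : ℝ) ≤ N := by exact_mod_cast hN
  have hr0 : 0 < r := by omega
  have hr' : (1 : ℝ) ≤ r := by exact_mod_cast hr0
  have hΛ1 : 1 ≤ Λ := by
    rw [hΛ, Real.le_logb_iff_rpow_le (by norm_num) (by linarith)]
    simpa using hN'
  have hd1 : 1 ≤ d := by
    refine le_trans ?_ hd
    have h1 : 1 ≤ (r : ℝ) ^ (3 * r) := one_le_pow₀ hr'
    have h2 : 1 ≤ Λ ^ 2 := one_le_pow₀ hΛ1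
    nlinarith
  have hd0 : 0 < d := by linarith
  have hE : (Fintype.card E : ℝ) * r = d * N := by
    have h : ((∑ v, H.degree v : ℕ) : ℝ) = Fintype.card E * r := by
      rw [sum_degree hH]; push_cast; ring
    rw [hddef, avgDegree, ← hNdef, div_mul_cancel₀ _ (by positivity), ← h]
    push_cast
    rfl
  set D := d ^ (1 / (2 * (r : ℝ))) with hDdef
  have hD1 : 1 ≤ D := Real.one_le_rpow hd1 (by positivity)
  have hΔ' : (H.maxDegree : ℝ) ≤ d * D := by
    rwa [Real.rpow_add hd0, Real.rpow_one] at hΔ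
  have hDr : (D ^ r) ^ 2 = d := by
    rw [← pow_mul, hDdef, ← Real.rpow_natCast, ← Real.rpow_mul hd0.le]
    push_cast
    rw [show 1 / (2 * (r : ℝ)) * (r * 2) = 1 by field_simp, Real.rpow_one]
  set s := D ^ r with hs
  have hs1 : 1 ≤ s := one_le_pow₀ hD1
  set x : ℝ := N / (2 * r ^ 2 * D) with hx
  have hx0 : 0 < x := by positivity
  -- The maximum covers x < 1, when D is large compared with N; a single edge is then enough, and
  -- the greedy bound is needed only at i = 0.
  set m := max 1 ⌊x⌋₊ with hm
  have hm0 : 0 < m := lt_of_lt_of_le one_pos (le_max_left _ _)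
  have hxm : x ≤ 2 * m := by
    have h1 : x < ⌊x⌋₊ + 1 := Nat.lt_floor_add_one x
    have h2 : (1 : ℝ) ≤ m := by exact_mod_cast hm0
    have h3 : (⌊x⌋₊ : ℝ) ≤ m := by exact_mod_cast le_max_right _ _
    linarith
  have hNm : (N : ℝ) ≤ 4 * r ^ 2 * D * m := by
    rw [hx, div_le_iff₀ (by positivity)] at hxm
    linarith
  have hmN : m ≤ N := by
    refine max_le (by omega) (Nat.floor_le_of_le ?_)
    rw [hx]
    refine div_le_self (by positivity) ?_
    have : (1 : ℝ) ≤ r ^ 2 := one_le_pow₀ hr'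
    nlinarith
  have hmx : ∀ i < m, (i : ℝ) ≤ x := by
    intro i hi
    rcases Nat.eq_zero_or_pos i with rfl | hi0
    · simpa using hx0.le
    · have : i ≤ ⌊x⌋₊ := by
        rcases le_max_iff.1 hi.le with h | h
        · rcases lt_max_iff.1 hi with h' | h'
          · omega
          · exact h'.le
        · exact h
      exact (Nat.le_floor_iff hx0.le).1 this
  have hgreedy : (d * N / (2 * r)) ^ m ≤ (H.matchings m).card * (m.factorial : ℝ) := by
    refine pow_le_card_matchings hr0 hH (by positivity) m fun i hi => ?_
    have h1 : (r : ℝ) * i * H.maxDegree ≤ r * x * (d * D) := by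
      gcongr
      exact hmx i hi
    have h2 : (r : ℝ) * x * (d * D) = d * N / (2 * r) := by
      rw [hx]; field_simp
    have h3 : (Fintype.card E : ℝ) = d * N / (2 * r) + d * N / (2 * r) := by
      rw [← hE]; field_simp; norm_num
    linarith
  -- Chosen so that (12r)^r D^r κ = d/2.
  set κ : ℝ := s / (2 * (12 * r) ^ r) with hκdef
  have hκ : (12 * (r : ℝ)) ^ r * D ^ r * κ < d := by
    rw [← hs, hκdef, ← hDr]
    have : (12 * (r : ℝ)) ^ r * s * (s / (2 * (12 * r) ^ r)) = s ^ 2 / 2 := by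
      field_simp
    rw [this]
    have : 0 < s ^ 2 := by positivity
    linarith
  set k := Nat.log 2 m + 1 with hk
  have hkΛ : (k : ℝ) ≤ 2 * Λ := by
    have h1 : (Nat.log 2 m : ℝ) ≤ Λ := by
      have : Nat.log 2 m ≤ Nat.log 2 N := Nat.log_mono_right hmN
      calc (Nat.log 2 m : ℝ) ≤ Nat.log 2 N := by exact_mod_cast this
        _ ≤ _ := by
          have := Real.natLog_le_logb N 2
          simpa using this
    rw [hk]; push_cast
    linarith
  have hκ16 : 16 * (r : ℝ) ^ 2 * k ≤ κ := by
    -- Squaring turns s into √d squared, that is d, and this is where the lower bound on d is used.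
    have h1 : 64 * (r : ℝ) ^ 2 * (12 * r) ^ r * Λ ≤ s := by
      refine le_of_sq_le_sq ?_ (by linarith)
      rw [hDr]
      refine le_trans ?_ hd
      have e : (64 * (r : ℝ) ^ 2 * (12 * r) ^ r * Λ) ^ 2 =
          4096 * (r : ℝ) ^ 4 * (144 * (r : ℝ) ^ 2) ^ r * Λ ^ 2 := by
        rw [show (144 * (r : ℝ) ^ 2) = (12 * r) ^ 2 by ring, pow_right_comm]; ring
      rw [e]
      gcongr
      exact pow_self_lower_bound hr
    rw [hκdef, le_div_iff₀ (by positivity)]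
    refine le_trans ?_ h1
    calc 16 * (r : ℝ) ^ 2 * k * (2 * (12 * r) ^ r)
        ≤ 16 * (r : ℝ) ^ 2 * (2 * Λ) * (2 * (12 * r) ^ r) := by gcongr
      _ = _ := by ring
  refine exists_regular_of_card_matchings (m := m) (k := k) hr0 hH
    (Nat.lt_pow_succ_log_self (by norm_num) m) (Nat.succ_pos _) hκ16 ?_
  exact choose_mul_pow_lt (by omega) hr0 hm0 hD1 (by positivity) hNm hκ hgreedy

end MultiHypergraph

/-! ### From hypergraphs to bipartite graphs. -/

namespace SimpleGraph

open Finset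
open scoped Classical

/-- The neighbourhoods of the vertices in one part of a bipartite graph, as a hypergraph on the
other part. -/
noncomputable def neighborHypergraph {W : Type*} [Fintype W] (G : SimpleGraph W)
    (A B : Finset W) : MultiHypergraph A B where
  edgeVerts b := univ.filter fun a : A => G.Adj a b

variable {W : Type*} [Fintype W] {G : SimpleGraph W} {A B : Finset W}

theorem mem_neighborHypergraph_edgeVerts {a : A} {b : B} :
    a ∈ (G.neighborHypergraph A B).edgeVerts b ↔ G.Adj a b := by
  simp [neighborHypergraph]

theorem neighborHypergraph_isUniform [DecidableRel G.Adj] (hG : G.IsBipartiteWith A B) {r : ℕ}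
    (hB : ∀ x ∈ B, G.degree x = r) : (G.neighborHypergraph A B).IsUniform r := by
  intro b
  rw [← hB b b.2, ← card_neighborFinset_eq_degree]
  refine card_bij (fun a _ => (a : W)) ?_ (fun _ _ _ _ h => Subtype.ext h) ?_
  · intro a ha
    rw [mem_neighborHypergraph_edgeVerts] at ha
    simpa using ha.symm
  · intro a ha
    rw [mem_neighborFinset] at ha
    exact ⟨⟨a, by simpa using hG.mem_of_mem_adj' (by simp) ha.symm⟩,
      mem_neighborHypergraph_edgeVerts.2 ha.symm, rfl⟩

theorem neighborHypergraph_degree [DecidableRel G.Adj] (hG : G.IsBipartiteWith A B) (a : A) :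
    (G.neighborHypergraph A B).degree a = G.degree a := by
  rw [← card_neighborFinset_eq_degree]
  refine card_bij (fun b _ => (b : W)) ?_ (fun _ _ _ _ h => Subtype.ext h) ?_
  · intro b hb
    rw [mem_filter, mem_neighborHypergraph_edgeVerts] at hb
    simpa using hb.2
  · intro b hb
    rw [mem_neighborFinset] at hb
    exact ⟨⟨b, by simpa using hG.mem_of_mem_adj (by simp) hb⟩,
      mem_filter.2 ⟨mem_univ _, mem_neighborHypergraph_edgeVerts.2 hb⟩, rfl⟩

theorem neighborHypergraph_avgDegree [DecidableRel G.Adj] (hG : G.IsBipartiteWith A B) :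
    (G.neighborHypergraph A B).avgDegree = #G.edgeFinset / #A := by
  have h : ∑ a : A, (G.neighborHypergraph A B).degree a = #G.edgeFinset := by
    rw [← isBipartiteWith_sum_degrees_eq_card_edges hG, ← sum_coe_sort A]
    exact sum_congr rfl fun a _ => neighborHypergraph_degree hG a
  rw [MultiHypergraph.avgDegree, ← h, Fintype.card_coe]
  push_cast
  rfl

/-- A regular subhypergraph of the neighbourhood hypergraph is a regular subgraph. -/
theorem exists_regular_subgraph_of_sub (hG : G.IsBipartiteWith A B) {r : ℕ}
    (hu : (G.neighborHypergraph A B).IsUniform r) (S : (G.neighborHypergraph A B).Sub)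
    (hne : S.verts.Nonempty) (hS : S.IsRegular r) :
    ∃ K : G.Subgraph, K.verts.Nonempty ∧ ∀ x ∈ K.verts, (K.neighborSet x).ncard = r := by
  have hAB : ∀ x, x ∈ A → x ∉ B := fun x hxA hxB =>
    Set.disjoint_left.1 hG.disjoint (by simpa using hxA) (by simpa using hxB)
  set K : G.Subgraph := (⊤ : G.Subgraph).induce
    (S.verts.map (Function.Embedding.subtype _) ∪ S.edges.map (Function.Embedding.subtype _) :
      Finset W) with hK
  have hadj : ∀ (a : A) (b : B), K.Adj a b ↔ (a ∈ S.verts ∧ b ∈ S.edges) ∧ G.Adj a b := by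
    intro a b
    have h1 := hAB a a.2
    have h2 : (b : W) ∉ A := fun h => hAB b h b.2
    simp [hK, h1, h2, and_assoc]
  have hadjA : ∀ (a : A) (x : W), K.Adj a x → x ∈ B := fun a x h => by
    simpa using hG.mem_of_mem_adj (by simp) h.adj_sub
  have hadjB : ∀ (b : B) (x : W), K.Adj b x → x ∈ A := fun b x h => by
    simpa using hG.mem_of_mem_adj' (by simp) h.adj_sub.symm
  refine ⟨K, ?_, ?_⟩
  · obtain ⟨a, ha⟩ := hne
    exact ⟨a, by simp [hK, ha]⟩
  · intro x hx
    simp only [hK, Subgraph.induce_verts, coe_union, coe_map, Set.mem_union, Set.mem_image,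
      mem_coe, Function.Embedding.coe_subtype] at hx
    rcases hx with ⟨a, ha, rfl⟩ | ⟨b, hb, rfl⟩
    · rw [← hS a ha, MultiHypergraph.Sub.degree,
        ← card_map (Function.Embedding.subtype _), ← Set.ncard_coe_finset]
      congr 1
      ext y
      simp only [Subgraph.mem_neighborSet, mem_coe, mem_map, mem_filter,
        mem_neighborHypergraph_edgeVerts, Function.Embedding.coe_subtype]
      constructor
      · intro h
        have h' := (hadj a ⟨y, hadjA a y h⟩).1 h
        exact ⟨⟨y, hadjA a y h⟩, ⟨h'.1.2, h'.2⟩, rfl⟩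
      · rintro ⟨b, ⟨hb, hab⟩, rfl⟩
        exact (hadj a b).2 ⟨⟨ha, hb⟩, hab⟩
    -- A chosen vertex of B keeps its whole neighbourhood, since a subhypergraph contains every
    -- vertex of its edges.
    · rw [← hu b, ← card_map (Function.Embedding.subtype _), ← Set.ncard_coe_finset]
      congr 1
      ext y
      simp only [Subgraph.mem_neighborSet, mem_coe, mem_map,
        mem_neighborHypergraph_edgeVerts, Function.Embedding.coe_subtype]
      constructor
      · intro h
        exact ⟨⟨y, hadjB b y h⟩, h.adj_sub.symm, rfl⟩
      · rintro ⟨a, hab, rfl⟩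
        have ha : a ∈ S.verts :=
          S.edgeVerts_subset b hb (mem_neighborHypergraph_edgeVerts.2 hab)
        exact ((hadj a b).2 ⟨⟨ha, hb⟩, hab⟩).symm

theorem exists_regular_subgraph [Nonempty W] [DecidableRel G.Adj] {n r : ℕ} {d Δ : ℝ}
    (hr : 2304 ≤ r) (hn : 2 ≤ n) (hW : Fintype.card W ≤ n) (hcov : ∀ x, x ∈ A ∨ x ∈ B)
    (hG : G.IsBipartiteWith A B) (hB : ∀ x ∈ B, G.degree x = r)
    (hA : ∀ x ∈ A, (G.degree x : ℝ) ≤ Δ) (he : (#G.edgeFinset : ℝ) = d * #A)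
    (hd : (r : ℝ) ^ (3 * r) * (Real.logb 2 (n : ℝ)) ^ 2 ≤ d)
    (hΔ : Δ ≤ d ^ (1 + 1 / (2 * (r : ℝ)))) :
    ∃ K : G.Subgraph, K.verts.Nonempty ∧ ∀ x ∈ K.verts, (K.neighborSet x).ncard = r := by
  have hu := neighborHypergraph_isUniform hG hB
  have hn' : (2 : ℝ) ≤ n := by exact_mod_cast hn
  have hr0 : (0 : ℝ) < r := by exact_mod_cast (by omega : 0 < r)
  have hlog : 0 < Real.logb 2 (n : ℝ) := Real.logb_pos (by norm_num) (by linarith)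
  have hd0 : 0 < d := lt_of_lt_of_le (by positivity) hd
  -- An empty B would leave no edges, while d|A| > 0. A vertex of B then has r neighbours in A,
  -- which gives the required |A| ≥ 2.
  have hBne : B.Nonempty := by
    by_contra hBe
    rw [not_nonempty_iff_eq_empty] at hBe
    obtain ⟨w⟩ := ‹Nonempty W›
    have hw : w ∈ A := (hcov w).resolve_right (by simp [hBe])
    have hsum := isBipartiteWith_sum_degrees_eq_card_edges' hG
    rw [hBe, sum_empty] at hsum
    rw [← hsum, Nat.cast_zero] at he
    have : (0 : ℝ) < #A := by exact_mod_cast card_pos.2 ⟨w, hw⟩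
    have := mul_pos hd0 this
    linarith
  obtain ⟨b, hb⟩ := hBne
  have hcard : r ≤ #A := by
    have h := card_le_univ ((G.neighborHypergraph A B).edgeVerts ⟨b, hb⟩)
    rwa [hu, Fintype.card_coe] at h
  have hA0 : (0 : ℝ) < #A := by exact_mod_cast (by omega : 0 < #A)
  have havg : (G.neighborHypergraph A B).avgDegree = d := by
    rw [neighborHypergraph_avgDegree hG, he, mul_div_cancel_right₀ _ hA0.ne']
  have hmax : ((G.neighborHypergraph A B).maxDegree : ℝ) ≤ d ^ (1 + 1 / (2 * (r : ℝ))) := by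
    refine le_trans ?_ hΔ
    have hAne : A.Nonempty := card_pos.1 (by omega)
    have : Nonempty A := hAne.to_subtype
    obtain ⟨a, -, ha⟩ := exists_mem_eq_sup (univ : Finset A) univ_nonempty
      (G.neighborHypergraph A B).degree
    rw [MultiHypergraph.maxDegree, ha, neighborHypergraph_degree hG]
    exact hA a a.2
  have hlogA : (r : ℝ) ^ (3 * r) * (Real.logb 2 (#A : ℝ)) ^ 2 ≤ d := by
    refine le_trans ?_ hd
    have h1 : #A ≤ n := (card_le_univ A).trans hW
    have h2 : (1 : ℝ) ≤ #A := by exact_mod_cast (by omega : 1 ≤ #A)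
    have h3 : 0 ≤ Real.logb 2 (#A : ℝ) := Real.logb_nonneg (by norm_num) h2
    gcongr
    norm_num
  obtain ⟨S, hne, hS⟩ := MultiHypergraph.exists_regular_of_avgDegree (G.neighborHypergraph A B) hr
    (by rw [Fintype.card_coe]; omega) hu (by rwa [havg]) (by rwa [havg, Fintype.card_coe])
  exact exists_regular_subgraph_of_sub hG hu S hne hS

end SimpleGraph

theorem lemma3p5 :
    ∃ r₀ : ℕ, ∀ r : ℕ, r₀ ≤ r →
      -- the multi-hypergraph form
      (∀ (V : Type*) (E : Type*) [Fintype V] [DecidableEq V] [Fintype E]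
        (H : MultiHypergraph V E),
        2 ≤ Fintype.card V →
        H.IsUniform r →
        (H.maxDegree : ℝ) ≤ H.avgDegree ^ (1 + 1 / (2 * (r : ℝ))) →
        (r : ℝ) ^ (3 * r) * (Real.logb 2 (Fintype.card V : ℝ)) ^ 2 ≤ H.avgDegree →
        ∃ S : H.Sub, S.verts.Nonempty ∧ S.IsRegular r) ∧
      -- the bipartite graph form
      (∀ (W : Type*) [Fintype W] [Nonempty W] (G : SimpleGraph W) [DecidableRel G.Adj]
        (A B : Finset W) (n : ℕ) (d Δ : ℝ),
        2 ≤ n →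
        Fintype.card W ≤ n →
        (∀ x, x ∈ A ∨ x ∈ B) →
        G.IsBipartiteWith (A : Set W) (B : Set W) →
        (∀ x ∈ B, G.degree x = r) →
        (∀ x ∈ A, (G.degree x : ℝ) ≤ Δ) →
        (G.edgeFinset.card : ℝ) = d * (A.card : ℝ) →
        (r : ℝ) ^ (3 * r) * (Real.logb 2 (n : ℝ)) ^ 2 ≤ d →
        Δ ≤ d ^ (1 + 1 / (2 * (r : ℝ))) →
        ∃ K : G.Subgraph, K.verts.Nonempty ∧ ∀ x ∈ K.verts, (K.neighborSet x).ncard = r) := by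
  refine ⟨2304, fun r hr => ⟨?_, ?_⟩⟩
  · intro V E _ _ _ H hN hH hΔ hd
    exact H.exists_regular_of_avgDegree hr hN hH hΔ hd
  · intro W _ _ G _ A B n d Δ hn hW hcov hG hB hA he hd hΔ
    exact SimpleGraph.exists_regular_subgraph hr hn hW hcov hG hB hA he hd hΔ
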